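/- Let $\varphi_0,\varphi_1,\dots$ be a standard (acceptable) enumeration of the partial computable functions $\mathbb N\rightharpoonup\mathbb N$, and let $W_j$ be the domain of $\varphi_j$. An index of a recursive presentation is a number $e=\langle i,j\rangle$ such that $\varphi_i$ is the (total, $\{0,1\}$-valued) characteristic function of a set $X_e\subseteq\mathbb N$ of generators and $W_j$ consists of codes of words in the letters $x^{\pm1}$, $x\in X_e$; it describes the recursively presented (r.p.) group $G_e=\langle X_e\mid \text{the words with codes in } W_j\rangle$. A group $G$ is residually nilpotent if for every $g\in G\setminus\{1\}$ there is a normal subgroup $N$ of $G$ with $g\notin N$ and $G/N$ nilpotent. For a set $A$ of indices of recursive presentations, let $B_A=\{e\in A : G_e \text{ is nilpotent}\}$. Detecting nilpotency is called $\Sigma^0_3$-complete in $A$ if 1. there is a $\Sigma^0_3$ set $S\subseteq\mathbb N$ with $A\cap S=B_A$, and 2. for every $\Sigma^0_3$ set $S\subseteq\mathbb N$ there is a computable function $f:\mathbb N\to\mathbb N$ with $f(n)\in A$ for all $n$, such that for all $n$, $n\in S$ if and only if $f(n)\in B_A$. **Theorem.** Detecting nilpotency is $\Sigma^0_3$-complete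 in the set of all indices of recursive presentations of groups, and it is also $\Sigma^0_3$-complete in the set of all indices of recursive presentations of residually nilpotent groups. -/

import Mathlib

/-! ### Computability -/

/-- The `e`-th partial computable function `φ_e : ℕ ⇀ ℕ`, in the standard enumeration of codes
for partial recursive functions (`Denumerable.ofNat` is a bijection from `ℕ` to codes). -/
def phi (e : ℕ) : ℕ →. ℕ :=
  (Denumerable.ofNat Nat.Partrec.Code e).eval

/-- The `e`-th computably enumerable set `W_e`, the domain of `φ_e`. -/
def ceSet (e : ℕ) : Set ℕ :=
  {x | (phi e x).Dom}

/-- `IsSigma0 n S`: the set `S ⊆ ℕ` is `Σ⁰ₙ`. A set is `Σ⁰₀` when it is computable, and it is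
`Σ⁰ₙ₊₁` when it is `{a | ∃ x, ⟨a, x⟩ ∈ T}` for some `Π⁰ₙ` set `T`, that is, some `T` whose
complement is `Σ⁰ₙ`. -/
def IsSigma0 : ℕ → Set ℕ → Prop
  | 0, S => ComputablePred (fun a => a ∈ S)
  | n + 1, S => ∃ T : Set ℕ, IsSigma0 n Tᶜ ∧ ∀ a, a ∈ S ↔ ∃ x, Nat.pair a x ∈ T

/-! ### Recursive presentations

An index of a recursive presentation is a pair `⟨i, j⟩` (coded by `Nat.pair`): `φ_i` is the
characteristic function of the set of generators, a computable set of natural numbers, and `W_j`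
is the set of (codes of) relators. A word is a finite list of letters `(x, b)`, where `(x, true)`
stands for the generator `x` and `(x, false)` for its inverse. -/

/-- The generators of the presentation with index `e`. -/
def rpGenerators (e : ℕ) : Set ℕ :=
  {x | 1 ∈ phi e.unpair.1 x}

/-- The number coding a word in the letters `x ^ ±1`, `x : ℕ`. -/
def wordCode (w : List (ℕ × Bool)) : ℕ :=
  Encodable.encode w

/-- The relators of the presentation with index `e`, as elements of the free group on its
generators. -/
def rpRelators (e : ℕ) : Set (FreeGroup (rpGenerators e)) :=
  {r | ∃ w : List (rpGenerators e × Bool),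
    wordCode (w.map fun l => ((l.1 : ℕ), l.2)) ∈ ceSet e.unpair.2 ∧ r = FreeGroup.mk w}

/-- The group described by the presentation with index `e`. -/
abbrev rpGroup (e : ℕ) : Type :=
  PresentedGroup (rpRelators e)

/-- `e` is an index of a recursive presentation: `φ_i` is total with values in `{0, 1}`, and every
element of `W_j` is the code of a word in the generators. -/
def IsRPIndex (e : ℕ) : Prop :=
  (∀ x, 0 ∈ phi e.unpair.1 x ∨ 1 ∈ phi e.unpair.1 x) ∧
    ∀ c ∈ ceSet e.unpair.2, ∃ w : List (ℕ × Bool),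
      wordCode w = c ∧ ∀ l ∈ w, l.1 ∈ rpGenerators e

/-! ### Detection problems -/

/-- Detecting the property `P` is `Γ` in the set `A` of indices: some set in `Γ` cuts out of `A`
exactly the indices of groups with property `P`. -/
def DetectionIn (Γ : Set ℕ → Prop) (A : Set ℕ) (P : (G : Type) → [Group G] → Prop) : Prop :=
  ∃ S : Set ℕ, Γ S ∧ A ∩ S = {e ∈ A | P (rpGroup e)}

/-- Detecting the property `P` is `Γ`-hard in the set `A` of indices: every set in `Γ` is
many-one reducible to the indices in `A` of groups with property `P`, by a computable function
all of whose values lie in `A`. -/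
def DetectionHard (Γ : Set ℕ → Prop) (A : Set ℕ) (P : (G : Type) → [Group G] → Prop) : Prop :=
  ∀ S : Set ℕ, Γ S → ∃ f : ℕ → ℕ, Computable f ∧ (∀ n, f n ∈ A) ∧
    ∀ n, n ∈ S ↔ f n ∈ {e ∈ A | P (rpGroup e)}

/-- Detecting the property `P` is `Γ`-complete in the set `A` of indices. -/
def DetectionComplete (Γ : Set ℕ → Prop) (A : Set ℕ) (P : (G : Type) → [Group G] → Prop) : Prop :=
  DetectionIn Γ A P ∧ DetectionHard Γ A P

/-- A group is residually nilpotent when every nontrivial element survives in some nilpotent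
quotient. -/
def IsResiduallyNilpotent (G : Type) [Group G] : Prop :=
  ∀ g : G, g ≠ 1 → ∃ (N : Subgroup G) (_ : N.Normal), g ∉ N ∧ Group.IsNilpotent (G ⧸ N)

/-- The set of all indices of recursive presentations of groups. -/
def rpIndices : Set ℕ :=
  {e | IsRPIndex e}

/-- The set of all indices of recursive presentations of residually nilpotent groups. -/
def resNilRPIndices : Set ℕ :=
  {e | IsRPIndex e ∧ IsResiduallyNilpotent (rpGroup e)}

/-! Upper bound: a group is nilpotent iff for some `c` every left-normed commutator with `c` entries
after the first is trivial. In a recursively presented group triviality of a word is `Σ⁰₁`: a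
certificate is a product of conjugates of relators and their inverses that freely reduces to the
same word (`mk_mem_normalClosure_iff`). This gives the prefix `∃ ∀ ∃`. To work with plain words over
`ℕ`, the letters outside the generating set are killed by extra relators.

Hardness: write `n ∈ S` as `∃ x, ∀ y, ∃ z, R`. To each `i = ⟨k, t⟩` attach the dihedral group of
order `2 ^ (k + 1)`, and let `K` be the c.e. set of those `i` for which some `x ≤ k` has a `z` for
every `y ≤ t`. The reduction outputs a presentation of the direct sum of the dihedral groups with `i
∉ K`. It is always residually nilpotent, since the summands are `2`-groups, and it is nilpotent iff
`k` is bounded on the complement of `K`. A true `x` puts every `i` with `k ≥ x` into `K`; if there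
is none, each `k` survives for some large `t` (`exists_forall_iff_exists_bound`). The relators are
c.e. because a word meets only finitely many summands, and each of these is either eventually
enumerated into `K` or has a decidable word problem. -/

/-! ### Nilpotency through iterated commutators -/

/-- The left-normed commutator `[…[[g, l₀], l₁], …]`. -/
def iteratedCommutator {G : Type*} [Group G] (g : G) (l : List G) : G :=
  l.foldl (fun a b => a * b * a⁻¹ * b⁻¹) g

theorem map_iteratedCommutator {G H : Type*} [Group G] [Group H] (f : G →* H) (g : G)
    (l : List G) : f (iteratedCommutator g l) = iteratedCommutator (f g) (l.map f) := by
  induction l generalizing g with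
  | nil => rfl
  | cons a l ih => simpa [iteratedCommutator] using ih (g * a * g⁻¹ * a⁻¹)

/-- An element lies in the next term of the series iff all its commutators lie in the current one,
so induction peels off the first entry of `l`. The upper series gives an elementwise criterion, with
no products of commutators to quantify over. -/
theorem mem_upperCentralSeries_iff {G : Type*} [Group G] (n : ℕ) (g : G) :
    g ∈ Subgroup.upperCentralSeries G n ↔
      ∀ l : List G, l.length = n → iteratedCommutator g l = 1 := by
  induction n generalizing g with
  | zero => simp [iteratedCommutator]
  | succ n ih =>
    rw [Subgroup.mem_upperCentralSeries_succ_iff]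
    simp only [ih]
    constructor
    · rintro h (_ | ⟨y, l⟩) hl
      · simp at hl
      · exact h y l (by simpa using hl)
    · intro h y l hl
      exact h (y :: l) (by simpa using hl)

theorem isNilpotent_iff_iteratedCommutator (G : Type*) [Group G] :
    Group.IsNilpotent G ↔
      ∃ n, ∀ (g : G) (l : List G), l.length = n → iteratedCommutator g l = 1 := by
  constructor
  · rintro ⟨n, hn⟩
    refine ⟨n, fun g => (mem_upperCentralSeries_iff n g).1 ?_⟩
    rw [hn]
    trivial
  · rintro ⟨n, hn⟩
    exact ⟨n, (Subgroup.eq_top_iff' _).2 fun g => (mem_upperCentralSeries_iff n g).2 (hn g)⟩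

/-! ### A normal form for `Σ⁰₃` sets -/

theorem isSigma0_three_iff (S : Set ℕ) :
    IsSigma0 3 S ↔ ∃ R : ℕ → Prop, ComputablePred R ∧ ∀ n, n ∈ S ↔
      ∃ x, ∀ y, ∃ z, R (Nat.pair (Nat.pair (Nat.pair n x) y) z) := by
  constructor
  · rintro ⟨T₁, ⟨T₂, ⟨T₃, h₃, e₃⟩, e₂⟩, e₁⟩
    refine ⟨(· ∈ T₃), h₃.not.of_eq fun a => by simp, fun n => ?_⟩
    rw [e₁]
    refine exists_congr fun x => ?_
    rw [← not_not (a := Nat.pair n x ∈ T₁), ← Set.mem_compl_iff, e₂, not_exists]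
    refine forall_congr' fun y => ?_
    rw [← Set.mem_compl_iff, e₃]
  · rintro ⟨R, hR, e⟩
    refine ⟨{a | ∀ y, ∃ z, R (Nat.pair (Nat.pair a y) z)},
      ⟨{a | ∀ z, ¬ R (Nat.pair a z)}, ⟨{a | R a}, hR.not, ?_⟩, ?_⟩, e⟩
    · intro a
      simp
    · intro a
      simp

/-! ### Words and primitive recursive operations on them -/

/-- Words in the letters `x ^ ±1`, `x : ℕ`. -/
abbrev NatWord : Type := List (ℕ × Bool)

/-- The word of the left-normed commutator of the given words. -/
def commutatorWord (w : NatWord) (l : List NatWord) : NatWord :=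
  l.foldl (fun a b => a ++ b ++ FreeGroup.invRev a ++ FreeGroup.invRev b) w

theorem mk_commutatorWord (w : NatWord) (l : List NatWord) :
    FreeGroup.mk (commutatorWord w l) =
      iteratedCommutator (FreeGroup.mk w) (l.map FreeGroup.mk) := by
  induction l generalizing w with
  | nil => rfl
  | cons a l ih =>
    simpa [commutatorWord, iteratedCommutator, ← FreeGroup.mul_mk, FreeGroup.inv_mk, mul_assoc]
      using ih (w ++ a ++ FreeGroup.invRev w ++ FreeGroup.invRev a)

theorem primrec_invRev : Primrec (FreeGroup.invRev : NatWord → NatWord) := by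
  have h : Primrec fun w : NatWord => (w.map fun l => (l.1, !l.2)).reverse := by
    have hg : Primrec₂ fun (_ : NatWord) (l : ℕ × Bool) => (l.1, !l.2) :=
      Primrec.pair (Primrec.fst.comp Primrec.snd)
        (Primrec.not.comp (Primrec.snd.comp Primrec.snd))
    exact Primrec.list_reverse.comp (Primrec.list_map Primrec.id hg)
  exact h

theorem primrec_reduce : Primrec (FreeGroup.reduce : NatWord → NatWord) := by
  have hx : Primrec fun p : (NatWord × (ℕ × Bool) × NatWord) × ((ℕ × Bool) × NatWord) =>
      p.1.2.1 := Primrec.fst.comp (Primrec.snd.comp Primrec.fst)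
  have hy : Primrec fun p : (NatWord × (ℕ × Bool) × NatWord) × ((ℕ × Bool) × NatWord) =>
      p.2.1 := Primrec.fst.comp Primrec.snd
  have ht : Primrec fun p : (NatWord × (ℕ × Bool) × NatWord) × ((ℕ × Bool) × NatWord) =>
      p.2.2 := Primrec.snd.comp Primrec.snd
  have hcons : Primrec₂ fun (p : NatWord × (ℕ × Bool) × NatWord) (q : (ℕ × Bool) × NatWord) =>
      if p.2.1.1 = q.1.1 ∧ p.2.1.2 = !q.1.2 then q.2 else p.2.1 :: q.1 :: q.2 :=
    Primrec.ite (PrimrecPred.and (Primrec.eq.comp (Primrec.fst.comp hx) (Primrec.fst.comp hy))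
      (Primrec.eq.comp (Primrec.snd.comp hx) (Primrec.not.comp (Primrec.snd.comp hy)))) ht
      (Primrec.list_cons.comp hx (Primrec.list_cons.comp hy ht))
  have hnil : Primrec fun p : NatWord × (ℕ × Bool) × NatWord => [p.2.1] :=
    Primrec.list_cons.comp (Primrec.fst.comp Primrec.snd) (Primrec.const [])
  have hstep : Primrec₂ fun (_ : NatWord) (q : (ℕ × Bool) × NatWord) =>
      (List.casesOn q.2 [q.1] fun hd tl =>
        if q.1.1 = hd.1 ∧ q.1.2 = !hd.2 then tl else q.1 :: hd :: tl : NatWord) :=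
    Primrec.list_casesOn (Primrec.snd.comp Primrec.snd) hnil hcons
  have h := Primrec.list_foldr (Primrec.id (α := NatWord)) (Primrec.const ([] : NatWord)) hstep
  refine h.of_eq fun w => ?_
  induction w with
  | nil => rfl
  | cons x w ih =>
    rw [id_eq] at ih
    rw [id_eq, List.foldr_cons, ih, FreeGroup.reduce.cons]

theorem primrec_commutatorWord : Primrec₂ commutatorWord := by
  have ha : Primrec fun p : (NatWord × List NatWord) × NatWord × NatWord => p.2.1 :=
    Primrec.fst.comp Primrec.snd
  have hb : Primrec fun p : (NatWord × List NatWord) × NatWord × NatWord => p.2.2 :=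
    Primrec.snd.comp Primrec.snd
  have h : Primrec₂ fun (_ : NatWord × List NatWord) (s : NatWord × NatWord) =>
      s.1 ++ s.2 ++ FreeGroup.invRev s.1 ++ FreeGroup.invRev s.2 :=
    Primrec.list_append.comp (Primrec.list_append.comp (Primrec.list_append.comp ha hb)
      (primrec_invRev.comp ha)) (primrec_invRev.comp hb)
  exact Primrec.list_foldl Primrec.snd Primrec.fst h

/-! ### Certificates for membership in a normal closure -/

/-- A factor `⟨u, b, r, k⟩` of a certificate stands for the conjugate of `r ^ ±1` by `u`; the
number `k` witnesses that `r` is a relator. -/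
abbrev ConjFactor : Type := NatWord × Bool × NatWord × ℕ

/-- The word described by a factor of a certificate. -/
def conjFactorWord (t : ConjFactor) : NatWord :=
  t.1 ++ (bif t.2.1 then t.2.2.1 else FreeGroup.invRev t.2.2.1) ++ FreeGroup.invRev t.1

theorem primrec_conjFactorWord : Primrec conjFactorWord := by
  have hr : Primrec fun t : ConjFactor => t.2.2.1 :=
    Primrec.fst.comp (Primrec.snd.comp Primrec.snd)
  exact Primrec.list_append.comp (Primrec.list_append.comp Primrec.fst
    (Primrec.cond (Primrec.fst.comp Primrec.snd) hr (primrec_invRev.comp hr)))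
    (primrec_invRev.comp Primrec.fst)

theorem mk_flatMap_conjFactorWord (z : List ConjFactor) :
    FreeGroup.mk (z.flatMap conjFactorWord) =
      (z.map fun t => FreeGroup.mk (conjFactorWord t)).prod := by
  induction z with
  | nil => rfl
  | cons t z ih => rw [List.flatMap_cons, ← FreeGroup.mul_mk, ih, List.map_cons, List.prod_cons]

theorem mk_conjFactorWord (t : ConjFactor) :
    FreeGroup.mk (conjFactorWord t) = FreeGroup.mk t.1 *
      (bif t.2.1 then FreeGroup.mk t.2.2.1 else (FreeGroup.mk t.2.2.1)⁻¹) *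
        (FreeGroup.mk t.1)⁻¹ := by
  obtain ⟨u, b, r, k⟩ := t
  cases b <;> simp [conjFactorWord, ← FreeGroup.mul_mk, FreeGroup.inv_mk, mul_assoc]

/-- The normal closure consists of the products of conjugates of relators and their inverses.
Comparing reduced words and storing the witness `k` in each factor makes the check of a given `z`
decidable whenever `D` is. -/
theorem mk_mem_normalClosure_iff (D : NatWord → ℕ → Prop) (w : NatWord) :
    FreeGroup.mk w ∈ Subgroup.normalClosure {g | ∃ r, (∃ k, D r k) ∧ g = FreeGroup.mk r} ↔
      ∃ z : List ConjFactor, (∀ t ∈ z, D t.2.2.1 t.2.2.2) ∧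
        FreeGroup.reduce (z.flatMap conjFactorWord) = FreeGroup.reduce w := by
  have key : ∀ g : FreeGroup ℕ,
      g ∈ Subgroup.normalClosure {g | ∃ r, (∃ k, D r k) ∧ g = FreeGroup.mk r} →
      ∃ z : List ConjFactor, (∀ t ∈ z, D t.2.2.1 t.2.2.2) ∧
        FreeGroup.mk (z.flatMap conjFactorWord) = g := by
    intro g hg
    induction hg using Subgroup.closure_induction with
    | mem x hx =>
      obtain ⟨a, ⟨r, ⟨k, hk⟩, rfl⟩, hc⟩ := Group.mem_conjugatesOfSet_iff.1 hx
      obtain ⟨c, rfl⟩ := isConj_iff.1 hc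
      refine ⟨[(c.toWord, true, r, k)], by simpa using hk, ?_⟩
      rw [mk_flatMap_conjFactorWord]
      rw [List.map_singleton, List.prod_singleton, mk_conjFactorWord]
      simp only [cond_true, FreeGroup.mk_toWord]
    | one => exact ⟨[], by simp, rfl⟩
    | mul x y _ _ hx hy =>
      obtain ⟨z₁, h₁, rfl⟩ := hx
      obtain ⟨z₂, h₂, rfl⟩ := hy
      refine ⟨z₁ ++ z₂, ?_, by simp [FreeGroup.mul_mk]⟩
      intro t ht
      exact (List.mem_append.1 ht).elim (h₁ t) (h₂ t)
    | inv x _ hx =>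
      obtain ⟨z, h, rfl⟩ := hx
      -- The inverse of a product of conjugates: reverse the order and flip each sign.
      refine ⟨(z.map fun t => (t.1, !t.2.1, t.2.2)).reverse, ?_, ?_⟩
      · intro t ht
        simp only [List.mem_reverse, List.mem_map] at ht
        obtain ⟨s, hs, rfl⟩ := ht
        exact h s hs
      · rw [mk_flatMap_conjFactorWord, mk_flatMap_conjFactorWord, List.prod_inv_reverse,
          List.map_reverse, List.map_map, List.map_map]
        congr 2
        refine List.map_congr_left fun t _ => ?_
        obtain ⟨u, b, r, k⟩ := t
        cases b <;> simp [mk_conjFactorWord, mul_assoc]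
  constructor
  · intro h
    obtain ⟨z, h₁, h₂⟩ := key _ h
    exact ⟨z, h₁, FreeGroup.reduce.sound h₂⟩
  · rintro ⟨z, h₁, h₂⟩
    rw [← FreeGroup.reduce.exact h₂, mk_flatMap_conjFactorWord]
    refine Subgroup.list_prod_mem _ fun x hx => ?_
    obtain ⟨t, ht, rfl⟩ := List.mem_map.1 hx
    rw [mk_conjFactorWord]
    refine Subgroup.normalClosure_normal.conj_mem _ ?_ _
    have : FreeGroup.mk t.2.2.1 ∈
        Subgroup.normalClosure {g | ∃ r, (∃ k, D r k) ∧ g = FreeGroup.mk r} :=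
      Subgroup.subset_normalClosure ⟨_, ⟨_, h₁ t ht⟩, rfl⟩
    cases t.2.1
    · exact inv_mem this
    · exact this

/-! ### Presentations on all natural numbers -/

/-- `k` witnesses that `r` is a relator of the presentation with index `e`, or a letter that is
not among its generators. -/
def RelatorWitness (e : ℕ) (r : NatWord) (k : ℕ) : Prop :=
  (Nat.Partrec.Code.evaln k (Denumerable.ofNat Nat.Partrec.Code e.unpair.2)
      (wordCode r)).isSome = true ∨
    (r = [(k.unpair.2, true)] ∧
      Nat.Partrec.Code.evaln k.unpair.1 (Denumerable.ofNat Nat.Partrec.Code e.unpair.1)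
        k.unpair.2 = some 0)

/-- In the first case `k` is the step bound of a computation; in the second it pairs a step bound
with the letter. Not being a generator is semidecidable here as convergence to `0`. -/
theorem exists_relatorWitness_iff (e : ℕ) (r : NatWord) :
    (∃ k, RelatorWitness e r k) ↔
      wordCode r ∈ ceSet e.unpair.2 ∨ ∃ x, r = [(x, true)] ∧ 0 ∈ phi e.unpair.1 x := by
  simp only [RelatorWitness, exists_or, ceSet, phi, Set.mem_ofPred_eq, Part.dom_iff_mem,
    Nat.Partrec.Code.evaln_complete, Option.isSome_iff_exists]
  refine or_congr ⟨?_, ?_⟩ ⟨?_, ?_⟩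
  · rintro ⟨k, y, h⟩
    exact ⟨y, k, h⟩
  · rintro ⟨y, k, h⟩
    exact ⟨k, y, h⟩
  · rintro ⟨k, h, h'⟩
    exact ⟨_, h, _, h'⟩
  · rintro ⟨x, h, k, h'⟩
    exact ⟨Nat.pair k x, by simpa using h, by simpa using h'⟩

/-- The relators of the presentation with index `e`, together with all letters that are not among
its generators. -/
def extendedRelators (e : ℕ) : Set (FreeGroup ℕ) :=
  {g | ∃ r, (∃ k, RelatorWitness e r k) ∧ g = FreeGroup.mk r}

theorem wordCode_injective : Function.Injective wordCode :=
  Encodable.encode_injective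

theorem MonoidHom.surjective_of_presentedGroup {α G : Type*} [Group G]
    {rels : Set (FreeGroup α)} (f : G →* PresentedGroup rels)
    (h : ∀ x, PresentedGroup.of x ∈ f.range) : Function.Surjective f :=
  fun y => PresentedGroup.generated_by rels f.range h y

/-- Nilpotency passes along surjections, so one in each direction suffices. Totality of the
characteristic function makes every letter a generator or trivial; the condition on relator codes
lets each relator be read back over the generators. -/
theorem isNilpotent_rpGroup_iff_extendedRelators {e : ℕ} (he : IsRPIndex e) :
    Group.IsNilpotent (rpGroup e) ↔ Group.IsNilpotent (PresentedGroup (extendedRelators e)) := by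
  classical
  constructor
  · intro h
    have hrel : ∀ r ∈ rpRelators e, FreeGroup.lift
        (fun x : rpGenerators e => (PresentedGroup.of x.1 : PresentedGroup (extendedRelators e)))
        r = 1 := by
      rintro _ ⟨w, hw, rfl⟩
      have := PresentedGroup.one_of_mem (rels := extendedRelators e)
        (x := FreeGroup.mk (w.map fun l => ((l.1 : ℕ), l.2)))
        ⟨_, (exists_relatorWitness_iff _ _).2 (Or.inl hw), rfl⟩
      rw [← this, ← FreeGroup.map.mk, ← MonoidHom.comp_apply]
      refine DFunLike.congr_fun (FreeGroup.ext_hom _ _ fun x => ?_) _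
      simp [PresentedGroup.of]
    refine Group.nilpotent_of_surjective (PresentedGroup.toGroup hrel)
      (MonoidHom.surjective_of_presentedGroup _ fun x => ?_)
    rcases he.1 x with hx | hx
    · have : (PresentedGroup.of x : PresentedGroup (extendedRelators e)) = 1 :=
        PresentedGroup.one_of_mem
          ⟨[(x, true)], (exists_relatorWitness_iff _ _).2 (Or.inr ⟨x, rfl, hx⟩), rfl⟩
      rw [this]
      exact one_mem _
    · exact ⟨PresentedGroup.of ⟨x, hx⟩, PresentedGroup.toGroup.of hrel⟩
  · intro h
    have hrel : ∀ r ∈ extendedRelators e, FreeGroup.lift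
        (fun x : ℕ => if hx : x ∈ rpGenerators e then
          (PresentedGroup.of ⟨x, hx⟩ : rpGroup e) else 1) r = 1 := by
      rintro _ ⟨w, hw, rfl⟩
      rcases (exists_relatorWitness_iff _ _).1 hw with hw | ⟨x, rfl, hx⟩
      · obtain ⟨w', hw', hl⟩ := he.2 _ hw
        obtain rfl := wordCode_injective hw'
        obtain ⟨v, rfl⟩ : ∃ v : List (rpGenerators e × Bool),
            w' = v.map fun l => ((l.1 : ℕ), l.2) := by
          refine ⟨w'.attach.map fun l => (⟨l.1.1, hl _ l.2⟩, l.1.2), ?_⟩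
          rw [List.map_map]
          exact (List.attach_map_subtype_val w').symm
        have := PresentedGroup.one_of_mem (rels := rpRelators e) (x := FreeGroup.mk v)
          ⟨v, hw, rfl⟩
        rw [← this, ← FreeGroup.map.mk, ← MonoidHom.comp_apply]
        refine DFunLike.congr_fun (FreeGroup.ext_hom _ _ fun x => ?_) _
        simp [PresentedGroup.of]
      · have : x ∉ rpGenerators e := fun h' => zero_ne_one (Part.mem_unique hx h')
        rw [← FreeGroup.of, FreeGroup.lift_apply_of, dif_neg this]
    refine Group.nilpotent_of_surjective (PresentedGroup.toGroup hrel)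
      (MonoidHom.surjective_of_presentedGroup _ fun x => ?_)
    refine ⟨PresentedGroup.of x.1, ?_⟩
    rw [PresentedGroup.toGroup.of hrel, dif_pos x.2]

/-! ### Nilpotency is `Σ⁰₃` -/

/-- The length condition sits below `∃ z` to keep the quantifiers in prenex form; lists of another
length are served by the empty certificate. -/
theorem isNilpotent_extendedRelators_iff (e : ℕ) :
    Group.IsNilpotent (PresentedGroup (extendedRelators e)) ↔
      ∃ c, ∀ q : NatWord × List NatWord, ∃ z : List ConjFactor, q.2.length = c →
        (∀ t ∈ z, RelatorWitness e t.2.2.1 t.2.2.2) ∧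
        FreeGroup.reduce (z.flatMap conjFactorWord) =
          FreeGroup.reduce (commutatorWord q.1 q.2) := by
  rw [isNilpotent_iff_iteratedCommutator]
  refine exists_congr fun c => ?_
  have hq : ∀ q : NatWord × List NatWord,
      iteratedCommutator (PresentedGroup.mk (extendedRelators e) (FreeGroup.mk q.1))
        (q.2.map fun w => PresentedGroup.mk (extendedRelators e) (FreeGroup.mk w)) = 1 ↔
      ∃ z : List ConjFactor, (∀ t ∈ z, RelatorWitness e t.2.2.1 t.2.2.2) ∧
        FreeGroup.reduce (z.flatMap conjFactorWord) =
          FreeGroup.reduce (commutatorWord q.1 q.2) := by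
    intro q
    rw [← mk_mem_normalClosure_iff, mk_commutatorWord, ← extendedRelators,
      ← PresentedGroup.mk_eq_one_iff, map_iteratedCommutator, List.map_map]
    rfl
  have hs : Function.Surjective
      fun w : NatWord => PresentedGroup.mk (extendedRelators e) (FreeGroup.mk w) :=
    (PresentedGroup.mk_surjective _).comp Quot.mk_surjective
  constructor
  · intro h q
    by_cases hc : q.2.length = c
    · obtain ⟨z, hz⟩ := (hq q).1 (h _ _ (by simpa using hc))
      exact ⟨z, fun _ => hz⟩
    · exact ⟨[], fun h' => absurd h' hc⟩
  · intro h g l hl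
    obtain ⟨w, rfl⟩ := hs g
    obtain ⟨l', rfl⟩ := List.map_surjective_iff.2 hs l
    obtain ⟨z, hz⟩ := h (w, l')
    exact (hq (w, l')).2 ⟨z, hz (by simpa using hl)⟩

theorem primrec_relatorWitness :
    PrimrecPred fun p : ℕ × NatWord × ℕ => RelatorWitness p.1 p.2.1 p.2.2 := by
  have hc : Primrec (Denumerable.ofNat Nat.Partrec.Code) := Primrec.ofNat _
  have hun : Primrec Nat.unpair := Primrec.unpair
  have hk : Primrec fun p : ℕ × NatWord × ℕ => p.2.2 := Primrec.snd.comp Primrec.snd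
  have hk₂ : Primrec fun p : ℕ × NatWord × ℕ => p.2.2.unpair.2 :=
    Primrec.snd.comp (hun.comp hk)
  have hr : Primrec fun p : ℕ × NatWord × ℕ => p.2.1 := Primrec.fst.comp Primrec.snd
  refine PrimrecPred.or ?_ (PrimrecPred.and ?_ ?_)
  · refine Primrec.eq.comp (Primrec.option_isSome.comp
      (Nat.Partrec.Code.primrec_evaln.comp (Primrec.pair (Primrec.pair hk ?_) ?_)))
      (Primrec.const true)
    · exact hc.comp (Primrec.snd.comp (hun.comp Primrec.fst))
    · exact Primrec.encode.comp hr
  · exact Primrec.eq.comp hr (Primrec.list_cons.comp (Primrec.pair hk₂ (Primrec.const true))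
      (Primrec.const []))
  · refine Primrec.eq.comp (Nat.Partrec.Code.primrec_evaln.comp
      (Primrec.pair (Primrec.pair (Primrec.fst.comp (hun.comp hk)) ?_) hk₂)) (Primrec.const _)
    exact hc.comp (Primrec.fst.comp (hun.comp Primrec.fst))

theorem isSigma0_three_isNilpotent_extendedRelators :
    IsSigma0 3 {e | Group.IsNilpotent (PresentedGroup (extendedRelators e))} := by
  let Q : (ℕ × ℕ) × (NatWord × List NatWord) × List ConjFactor → Prop := fun p =>
    p.2.1.2.length = p.1.2 → (∀ t ∈ p.2.2, RelatorWitness p.1.1 t.2.2.1 t.2.2.2) ∧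
      FreeGroup.reduce (p.2.2.flatMap conjFactorWord) =
        FreeGroup.reduce (commutatorWord p.2.1.1 p.2.1.2)
  have hQ : PrimrecPred Q := by
    have hz : Primrec fun p : (ℕ × ℕ) × (NatWord × List NatWord) × List ConjFactor => p.2.2 :=
      Primrec.snd.comp Primrec.snd
    have hq : Primrec fun p : (ℕ × ℕ) × (NatWord × List NatWord) × List ConjFactor => p.2.1 :=
      Primrec.fst.comp Primrec.snd
    have h₁ : PrimrecRel fun (t : ConjFactor) (e : ℕ) => RelatorWitness e t.2.2.1 t.2.2.2 :=
      (primrec_relatorWitness.comp (Primrec.pair Primrec.snd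
        (Primrec.snd.comp (Primrec.snd.comp Primrec.fst)))).primrecRel
    refine PrimrecPred.of_eq (PrimrecPred.or (PrimrecPred.not (Primrec.eq.comp
      (Primrec.list_length.comp (Primrec.snd.comp hq)) (Primrec.snd.comp Primrec.fst)))
      (PrimrecPred.and (h₁.forall_mem_list.comp hz (Primrec.fst.comp Primrec.fst))
        (Primrec.eq.comp (primrec_reduce.comp (Primrec.list_flatMap hz
          (primrec_conjFactorWord.comp Primrec.snd).to₂))
          (primrec_reduce.comp (primrec_commutatorWord.comp (Primrec.fst.comp hq)
            (Primrec.snd.comp hq)))))) fun p => ?_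
    exact imp_iff_not_or.symm
  have hun : Primrec Nat.unpair := Primrec.unpair
  -- Numbers that decode to nothing yield a default value, which is harmless: every `q` and every
  -- `z` is decoded from its own code.
  have hf : Primrec fun a : ℕ => (a.unpair.1.unpair.1.unpair,
      (Encodable.decode (α := NatWord × List NatWord) a.unpair.1.unpair.2).getD default,
      (Encodable.decode (α := List ConjFactor) a.unpair.2).getD default) := by
    refine Primrec.pair ?_ (Primrec.pair ?_ ?_)
    · exact hun.comp (Primrec.fst.comp (hun.comp (Primrec.fst.comp hun)))
    · exact Primrec.option_getD_default.comp (Primrec.decode.comp (Primrec.snd.comp (hun.comp (Primrec.fst.comp hun))))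
    · exact Primrec.option_getD_default.comp (Primrec.decode.comp (Primrec.snd.comp hun))
  refine (isSigma0_three_iff _).2 ⟨_, (hQ.comp hf).computablePred, fun e => ?_⟩
  rw [Set.mem_ofPred_eq, isNilpotent_extendedRelators_iff]
  refine exists_congr fun c => ?_
  simp only [Nat.unpair_pair, Q]
  constructor
  · intro h y
    obtain ⟨z, hz⟩ := h ((Encodable.decode y).getD default)
    exact ⟨Encodable.encode z, by simpa using hz⟩
  · intro h q
    obtain ⟨z, hz⟩ := h (Encodable.encode q)
    exact ⟨(Encodable.decode z).getD default, by simpa using hz⟩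

theorem detectionIn_isNilpotent {A : Set ℕ} (hA : A ⊆ rpIndices) :
    DetectionIn (IsSigma0 3) A (fun G _ => Group.IsNilpotent G) := by
  refine ⟨_, isSigma0_three_isNilpotent_extendedRelators, Set.ext fun e => ?_⟩
  refine and_congr_right fun he => ?_
  exact (isNilpotent_rpGroup_iff_extendedRelators (hA he)).symm

/-! ### Groups with a separating family of maps to dihedral `2`-groups -/

instance isNilpotent_dihedralGroup_two_pow (k : ℕ) :
    Group.IsNilpotent (DihedralGroup (2 ^ k)) := by
  have : Fact (Nat.Prime 2) := ⟨Nat.prime_two⟩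
  refine IsPGroup.isNilpotent (p := 2) (IsPGroup.of_card (n := k + 1) ?_)
  rw [DihedralGroup.nat_card, pow_succ, mul_comm]

/-- A reflection inverts rotations, so each commutator with it doubles the exponent. -/
theorem iteratedCommutator_replicate_sr {N : ℕ} (c : ℕ) (j : ZMod N) :
    iteratedCommutator (DihedralGroup.r j) (List.replicate c (DihedralGroup.sr 0)) =
      DihedralGroup.r (2 ^ c * j) := by
  induction c generalizing j with
  | zero => simp [iteratedCommutator]
  | succ c ih =>
    have := ih (2 * j)
    rw [List.replicate_succ, pow_succ, mul_assoc, ← this]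
    simp [iteratedCommutator, two_mul]

theorem r_two_pow_ne_one {c k : ℕ} (h : c < k) :
    (DihedralGroup.r (2 ^ c * 1) : DihedralGroup (2 ^ k)) ≠ 1 := by
  rw [DihedralGroup.one_def, Ne, DihedralGroup.r.injEq, mul_one]
  have : ((2 ^ c : ℕ) : ZMod (2 ^ k)) ≠ 0 := by
    rw [Ne, ZMod.natCast_eq_zero_iff, Nat.pow_dvd_pow_iff_le_right']
    omega
  simpa using this

section Separating

variable {G : Type} [Group G] {ι : Type} {k : ι → ℕ} (ψ : ∀ i, G →* DihedralGroup (2 ^ k i))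

theorem isResiduallyNilpotent_of_separating (hψ : ∀ g, (∀ i, ψ i g = 1) → g = 1) :
    IsResiduallyNilpotent G := by
  intro g hg
  obtain ⟨i, hi⟩ : ∃ i, ψ i g ≠ 1 := by
    by_contra! h
    exact hg (hψ g h)
  exact ⟨(ψ i).ker, inferInstance, hi,
    Group.nilpotent_of_mulEquiv (QuotientGroup.quotientKerEquivRange (ψ i)).symm⟩

/-- The group embeds in a product of dihedral groups, so a common bound on their classes suffices.
Conversely, lifts of `r 1` and `sr 0` give commutators of length `c` that survive wherever `c < k
i`. -/
theorem isNilpotent_iff_of_separating (hψ : ∀ g, (∀ i, ψ i g = 1) → g = 1)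
    (hr : ∀ i, ∃ a, ψ i a = DihedralGroup.r 1) (hs : ∀ i, ∃ b, ψ i b = DihedralGroup.sr 0) :
    Group.IsNilpotent G ↔ ∃ B, ∀ i, k i < B := by
  rw [isNilpotent_iff_iteratedCommutator]
  constructor
  · rintro ⟨c, hc⟩
    refine ⟨c + 1, fun i => ?_⟩
    obtain ⟨a, ha⟩ := hr i
    obtain ⟨b, hb⟩ := hs i
    have h := congrArg (ψ i) (hc a (List.replicate c b) List.length_replicate)
    rw [map_iteratedCommutator, map_one, List.map_replicate, ha, hb,
      iteratedCommutator_replicate_sr] at h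
    by_contra! hk
    exact r_two_pow_ne_one (by omega) h
  · rintro ⟨B, hB⟩
    let cl : ℕ → ℕ := fun m => Group.nilpotencyClass (DihedralGroup (2 ^ m))
    -- Only finitely many dihedral groups have `k i < B`, so the maximum of their classes works and
    -- no class formula is needed.
    refine ⟨(Finset.range B).sup cl, fun g l hl => hψ _ fun i => ?_⟩
    rw [map_iteratedCommutator]
    refine (mem_upperCentralSeries_iff ((Finset.range B).sup cl) (ψ i g)).1 ?_ _ (by simpa using hl)
    have : cl (k i) ≤ (Finset.range B).sup cl :=
      Finset.le_sup (f := cl) (Finset.mem_range.2 (hB i))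
    rw [Subgroup.upperCentralSeries_eq_top_iff_nilpotencyClass_le.2 this]
    trivial

end Separating

/-! ### Evaluating words in dihedral groups -/

/-- The number `⟨i, 0⟩` names the rotation, and `⟨i, b + 1⟩` names the reflection, in the `i`-th
dihedral group; all other numbers name the identity of that group. -/
def dihedralGenerator (N i x : ℕ) : DihedralGroup N :=
  if x.unpair.1 = i then
    (if x.unpair.2 = 0 then DihedralGroup.r 1 else DihedralGroup.sr 0)
  else 1

/-- The element `r j` is coded by `(false, j)`, and `sr j` is coded by `(true, j)`. -/
def dihedralDecode (N : ℕ) (s : Bool × ℕ) : DihedralGroup N :=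
  bif s.1 then DihedralGroup.sr s.2 else DihedralGroup.r s.2

/-- Left multiplication by a letter, on codes of elements of a dihedral group. -/
def dihedralStep (N i : ℕ) (l : ℕ × Bool) (s : Bool × ℕ) : Bool × ℕ :=
  if l.1.unpair.1 = i then
    -- Since `r 1 * r j = r (j + 1)` but `r 1 * sr j = sr (j - 1)`, the exponent drops exactly when
    -- `l.2 = s.1`; `N - 1` stands for `-1` modulo `N`. A reflection is its own inverse, so its sign
    -- is ignored.
    (if l.1.unpair.2 = 0 then (s.1, s.2 + if l.2 = s.1 then N - 1 else 1) else (!s.1, s.2))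
  else s

/-- The code of the value of a word in the `i`-th dihedral group. -/
def dihedralEval (N i : ℕ) (w : NatWord) : Bool × ℕ :=
  w.foldr (dihedralStep N i) (false, 0)

theorem dihedralDecode_dihedralStep {N : ℕ} (hN : 1 ≤ N) (i : ℕ) (l : ℕ × Bool)
    (s : Bool × ℕ) : dihedralDecode N (dihedralStep N i l s) =
      cond l.2 (dihedralGenerator N i l.1) (dihedralGenerator N i l.1)⁻¹ * dihedralDecode N s := by
  obtain ⟨x, b⟩ := l
  obtain ⟨c, j⟩ := s
  unfold dihedralStep dihedralGenerator
  by_cases h₁ : x.unpair.1 = i <;> by_cases h₂ : x.unpair.2 = 0 <;> cases b <;> cases c <;>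
    simp [h₁, h₂, dihedralDecode, Nat.cast_sub hN, add_comm, sub_eq_add_neg]

theorem lift_dihedralGenerator_mk_eq_one_iff {N : ℕ} (hN : 1 ≤ N) (i : ℕ) (w : NatWord) :
    FreeGroup.lift (dihedralGenerator N i) (FreeGroup.mk w) = 1 ↔
      (dihedralEval N i w).1 = false ∧ (dihedralEval N i w).2 % N = 0 := by
  have h : FreeGroup.lift (dihedralGenerator N i) (FreeGroup.mk w) =
      dihedralDecode N (dihedralEval N i w) := by
    rw [FreeGroup.lift_mk]
    induction w with
    | nil => simp [dihedralEval, dihedralDecode]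
    | cons l w ih =>
      rw [List.map_cons, List.prod_cons, ih, ← dihedralDecode_dihedralStep hN]
      rfl
  rw [h]
  obtain ⟨b, j⟩ := dihedralEval N i w
  cases b
  · simp [dihedralDecode, ← Nat.dvd_iff_mod_eq_zero, DihedralGroup.one_def,
      ZMod.natCast_eq_zero_iff, -DihedralGroup.r_zero]
  · simp [dihedralDecode, DihedralGroup.one_def, -DihedralGroup.r_zero]

theorem lift_dihedralGenerator_eq_one_of_forall_ne (N i : ℕ) (w : NatWord)
    (h : ∀ l ∈ w, l.1.unpair.1 ≠ i) :
    FreeGroup.lift (dihedralGenerator N i) (FreeGroup.mk w) = 1 := by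
  rw [FreeGroup.lift_mk]
  refine List.prod_eq_one fun g hg => ?_
  obtain ⟨l, hl, rfl⟩ := List.mem_map.1 hg
  cases l.2 <;> simp [dihedralGenerator, h l hl]

/-- This bounds the summands that a word can meet by its code, turning a quantifier over all `i`
into a bounded one. -/
theorem fst_lt_wordCode {w : NatWord} {l : ℕ × Bool} (h : l ∈ w) : l.1 < wordCode w := by
  induction w with
  | nil => simp at h
  | cons a w ih =>
    have hw : wordCode (a :: w) = (Nat.pair (Encodable.encode a) (wordCode w)).succ := rfl
    have ha : Encodable.encode a = Nat.pair a.1 (Encodable.encode a.2) := rfl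
    have h₁ := Nat.left_le_pair (Encodable.encode a) (wordCode w)
    have h₂ := Nat.right_le_pair (Encodable.encode a) (wordCode w)
    have h₃ := Nat.left_le_pair a.1 (Encodable.encode a.2)
    rcases List.mem_cons.1 h with rfl | h
    · omega
    · have := ih h
      omega

theorem primrec_dihedralEval :
    Primrec fun p : (ℕ × ℕ) × NatWord => dihedralEval p.1.1 p.1.2 p.2 := by
  refine Primrec.list_foldr (α := (ℕ × ℕ) × NatWord)
    (h := fun p q => dihedralStep p.1.1 p.1.2 q.1 q.2) Primrec.snd (Primrec.const (false, 0)) ?_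
  have hN : Primrec fun p : ((ℕ × ℕ) × NatWord) × (ℕ × Bool) × Bool × ℕ => p.1.1.1 :=
    Primrec.fst.comp (Primrec.fst.comp Primrec.fst)
  have hi : Primrec fun p : ((ℕ × ℕ) × NatWord) × (ℕ × Bool) × Bool × ℕ => p.1.1.2 :=
    Primrec.snd.comp (Primrec.fst.comp Primrec.fst)
  have hx : Primrec fun p : ((ℕ × ℕ) × NatWord) × (ℕ × Bool) × Bool × ℕ => p.2.1.1.unpair :=
    Primrec.unpair.comp (Primrec.fst.comp (Primrec.fst.comp Primrec.snd))
  have hb : Primrec fun p : ((ℕ × ℕ) × NatWord) × (ℕ × Bool) × Bool × ℕ => p.2.1.2 :=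
    Primrec.snd.comp (Primrec.fst.comp Primrec.snd)
  have hs : Primrec fun p : ((ℕ × ℕ) × NatWord) × (ℕ × Bool) × Bool × ℕ => p.2.2 :=
    Primrec.snd.comp Primrec.snd
  refine Primrec.ite (Primrec.eq.comp (Primrec.fst.comp hx) hi) (Primrec.ite
    (Primrec.eq.comp (Primrec.snd.comp hx) (Primrec.const 0))
    (Primrec.pair (Primrec.fst.comp hs) (Primrec.nat_add.comp (Primrec.snd.comp hs)
      (Primrec.ite (Primrec.eq.comp hb (Primrec.fst.comp hs))
        (Primrec.nat_sub.comp hN (Primrec.const 1)) (Primrec.const 1))))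
    (Primrec.pair (Primrec.not.comp (Primrec.fst.comp hs)) (Primrec.snd.comp hs))) hs

theorem primrec_two_pow : Primrec fun k : ℕ => 2 ^ k := by
  refine (Primrec.nat_rec₁ 1 (f := fun _ m => 2 * m) ?_).of_eq fun k => ?_
  · exact (Primrec.nat_mul.comp (Primrec.const 2) Primrec.snd).to₂
  · induction k with
    | zero => rfl
    | succ k ih => rw [pow_succ, mul_comm, ← ih]

/-- The word `w` is trivial in the `i`-th dihedral group, of order `2 ^ (k + 1)` for
`i = ⟨k, t⟩`. -/
def IsTrivialAt (i : ℕ) (w : NatWord) : Prop :=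
  FreeGroup.lift (dihedralGenerator (2 ^ i.unpair.1) i) (FreeGroup.mk w) = 1

theorem primrec_isTrivialAt : PrimrecPred fun p : ℕ × NatWord => IsTrivialAt p.1 p.2 := by
  have hN : Primrec fun p : ℕ × NatWord => 2 ^ p.1.unpair.1 :=
    primrec_two_pow.comp (Primrec.fst.comp (Primrec.unpair.comp Primrec.fst))
  have he : Primrec fun p : ℕ × NatWord => dihedralEval (2 ^ p.1.unpair.1) p.1 p.2 :=
    primrec_dihedralEval.comp (Primrec.pair (Primrec.pair hN Primrec.fst) Primrec.snd)
  refine PrimrecPred.of_eq (PrimrecPred.and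
    (Primrec.eq.comp (Primrec.fst.comp he) (Primrec.const false))
    (Primrec.eq.comp (Primrec.nat_mod.comp (Primrec.snd.comp he) hN) (Primrec.const 0)))
    fun p => ?_
  exact (lift_dihedralGenerator_mk_eq_one_iff Nat.one_le_two_pow _ _).symm

/-! ### Computable predicates and indices -/

theorem ComputablePred.comp_computable {α β : Type*} [Primcodable α] [Primcodable β]
    {p : β → Prop} {f : α → β} (hp : ComputablePred p) (hf : Computable f) :
    ComputablePred fun a => p (f a) := by
  obtain ⟨_, hp⟩ := hp
  exact ⟨fun a => inferInstance, hp.comp hf⟩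

theorem ComputablePred.conj {α : Type*} [Primcodable α] {p q : α → Prop}
    (hp : ComputablePred p) (hq : ComputablePred q) : ComputablePred fun a => p a ∧ q a := by
  obtain ⟨_, hp⟩ := hp
  obtain ⟨_, hq⟩ := hq
  exact ⟨fun a => inferInstance, (Primrec.and.to_comp.comp hp hq).of_eq fun a => by simp⟩

theorem ComputablePred.disj {α : Type*} [Primcodable α] {p q : α → Prop}
    (hp : ComputablePred p) (hq : ComputablePred q) : ComputablePred fun a => p a ∨ q a := by
  obtain ⟨_, hp⟩ := hp
  obtain ⟨_, hq⟩ := hq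
  exact ⟨fun a => inferInstance, (Primrec.or.to_comp.comp hp hq).of_eq fun a => by simp⟩

theorem ComputablePred.forall_lt {α : Type*} [Primcodable α] {p : α × ℕ → Prop}
    (hp : ComputablePred p) {b : α → ℕ} (hb : Computable b) :
    ComputablePred fun a => ∀ x < b a, p (a, x) := by
  obtain ⟨_, hp⟩ := hp
  have hstep : Computable₂ fun (a : α) (q : ℕ × Bool) => q.2 && decide (p (a, q.1)) :=
    Primrec.and.to_comp.comp (Computable.snd.comp Computable.snd)
      (hp.comp (Computable.pair Computable.fst (Computable.fst.comp Computable.snd)))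
  refine ComputablePred.computable_iff.2
    ⟨_, Computable.nat_rec hb (Computable.const true) hstep, ?_⟩
  · funext a
    generalize b a = m
    induction m with
    | zero => simp
    | succ m ih =>
      simp only [Bool.and_eq_true, decide_eq_true_eq, ← ih, Nat.forall_lt_succ_right]

theorem ComputablePred.exists_lt {α : Type*} [Primcodable α] {p : α × ℕ → Prop}
    (hp : ComputablePred p) {b : α → ℕ} (hb : Computable b) :
    ComputablePred fun a => ∃ x < b a, p (a, x) :=
  (hp.not.forall_lt hb).not.of_eq fun a => by simp

/-- Unbounded search for `m` gives one partial computable function of `⟨n, c⟩`; currying its code in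
`n` yields the indices uniformly (the s-m-n theorem). -/
theorem exists_computable_ceSet_eq {P : ℕ × ℕ × ℕ → Prop} (hP : ComputablePred P) :
    ∃ g : ℕ → ℕ, Computable g ∧ ∀ n, ceSet (g n) = {c | ∃ m, P (n, c, m)} := by
  obtain ⟨_, hP⟩ := hP
  have hpart : Partrec fun a : ℕ =>
      Nat.rfind fun m => Part.some (decide (P (a.unpair.1, a.unpair.2, m))) := by
    refine Partrec.rfind ?_
    have hu : Computable fun p : ℕ × ℕ => p.1.unpair :=
      Primrec.unpair.to_comp.comp Computable.fst
    exact (hP.comp (Computable.pair (Computable.fst.comp hu)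
      (Computable.pair (Computable.snd.comp hu) Computable.snd))).partrec.to₂
  obtain ⟨c₀, hc₀⟩ := Nat.Partrec.Code.exists_code.1 (Partrec.nat_iff.1 hpart)
  refine ⟨fun n => Encodable.encode (Nat.Partrec.Code.curry c₀ n),
    (Primrec.encode.comp (Nat.Partrec.Code.primrec₂_curry.comp (Primrec.const c₀)
      Primrec.id)).to_comp, fun n => Set.ext fun c => ?_⟩
  have h : c ∈ ceSet (Encodable.encode (Nat.Partrec.Code.curry c₀ n)) ↔
      (Nat.rfind fun m => Part.some (decide (P (n, c, m)))).Dom := by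
    simp [ceSet, phi, Nat.Partrec.Code.eval_curry, hc₀]
  exact h.trans (Nat.rfind_dom.trans (by simp))

/-- An index of the constant function `1`. -/
def constOneIndex : ℕ :=
  Encodable.encode (Nat.Partrec.Code.const 1)

theorem phi_constOneIndex (x : ℕ) : phi constOneIndex x = Part.some 1 := by
  simp [phi, constOneIndex, Nat.Partrec.Code.eval_const]

/-! ### Nilpotency is `Σ⁰₃`-hard -/

/-- The presentation with index `e` has all numbers as generators, and its relators are the words
that are trivial in all dihedral groups whose number is not in `K`. -/
structure PresentsDihedralSum (K : Set ℕ) (e : ℕ) : Prop where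
  generators : e.unpair.1 = constOneIndex
  relators : ∀ c, c ∈ ceSet e.unpair.2 ↔ ∃ w, wordCode w = c ∧ ∀ i ∉ K, IsTrivialAt i w

namespace PresentsDihedralSum

variable {K : Set ℕ} {e : ℕ}

theorem mem_rpGenerators (h : PresentsDihedralSum K e) (x : ℕ) : x ∈ rpGenerators e := by
  simp [rpGenerators, h.generators, phi_constOneIndex]

theorem isRPIndex (h : PresentsDihedralSum K e) : IsRPIndex e := by
  refine ⟨fun x => Or.inr (h.mem_rpGenerators x), fun c hc => ?_⟩
  obtain ⟨w, hw, -⟩ := (h.relators c).1 hc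
  exact ⟨w, hw, fun l _ => h.mem_rpGenerators _⟩

theorem lift_mk_eq_one_iff (i : ℕ) (w : List (rpGenerators e × Bool)) :
    FreeGroup.lift (fun x : rpGenerators e => dihedralGenerator (2 ^ i.unpair.1) i x.1)
      (FreeGroup.mk w) = 1 ↔ IsTrivialAt i (w.map fun l => ((l.1 : ℕ), l.2)) := by
  rw [IsTrivialAt, FreeGroup.lift_mk, FreeGroup.lift_mk, List.map_map]
  rfl

theorem mk_mem_rpRelators_iff (h : PresentsDihedralSum K e) (w : List (rpGenerators e × Bool)) :
    wordCode (w.map fun l => ((l.1 : ℕ), l.2)) ∈ ceSet e.unpair.2 ↔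
      ∀ i ∉ K, FreeGroup.lift
        (fun x : rpGenerators e => dihedralGenerator (2 ^ i.unpair.1) i x.1)
        (FreeGroup.mk w) = 1 := by
  simp only [lift_mk_eq_one_iff]
  rw [h.relators]
  constructor
  · rintro ⟨v, hv, hi⟩
    rwa [wordCode_injective hv] at hi
  · exact fun hi => ⟨_, rfl, hi⟩

/-- The projection of the presented group to one of the dihedral groups. -/
def proj (h : PresentsDihedralSum K e) (i : (Kᶜ : Set ℕ)) :
    rpGroup e →* DihedralGroup (2 ^ i.1.unpair.1) :=
  PresentedGroup.toGroup
    (f := fun x : rpGenerators e => dihedralGenerator (2 ^ i.1.unpair.1) i.1 x.1) (by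
      rintro _ ⟨w, hw, rfl⟩
      exact (h.mk_mem_rpRelators_iff w).1 hw i.1 i.2)

theorem proj_of (h : PresentsDihedralSum K e) (i : (Kᶜ : Set ℕ)) (x : rpGenerators e) :
    h.proj i (PresentedGroup.of x) = dihedralGenerator (2 ^ i.1.unpair.1) i.1 x.1 :=
  PresentedGroup.toGroup.of _

theorem eq_one_of_forall_proj (h : PresentsDihedralSum K e) (g : rpGroup e)
    (hg : ∀ i, h.proj i g = 1) : g = 1 := by
  obtain ⟨x, rfl⟩ := PresentedGroup.mk_surjective _ g
  obtain ⟨w, rfl⟩ : ∃ w, FreeGroup.mk w = x := Quot.mk_surjective x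
  exact PresentedGroup.one_of_mem
    ⟨w, (h.mk_mem_rpRelators_iff w).2 fun i hi => hg ⟨i, hi⟩, rfl⟩

theorem isResiduallyNilpotent (h : PresentsDihedralSum K e) :
    IsResiduallyNilpotent (rpGroup e) :=
  isResiduallyNilpotent_of_separating h.proj h.eq_one_of_forall_proj

theorem isNilpotent_iff (h : PresentsDihedralSum K e) :
    Group.IsNilpotent (rpGroup e) ↔ ∃ B, ∀ i ∉ K, i.unpair.1 < B := by
  rw [isNilpotent_iff_of_separating h.proj h.eq_one_of_forall_proj]
  · simp
  · intro i
    refine ⟨PresentedGroup.of ⟨Nat.pair i.1 0, h.mem_rpGenerators _⟩, ?_⟩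
    simp [proj_of, dihedralGenerator]
  · intro i
    refine ⟨PresentedGroup.of ⟨Nat.pair i.1 1, h.mem_rpGenerators _⟩, ?_⟩
    simp [proj_of, dihedralGenerator]

end PresentsDihedralSum

/-- A word is accepted at stage `m` if each `i` below its code is already in `K` by stage `m` or the
word is trivial at `i`. Monotonicity in `m` lets one stage serve all these `i` together. -/
theorem exists_computable_presentsDihedralSum {D : ℕ × ℕ × ℕ → Prop} (hD : ComputablePred D)
    (hmono : ∀ n i m m', m ≤ m' → D (n, i, m) → D (n, i, m')) :
    ∃ f : ℕ → ℕ, Computable f ∧ ∀ n, PresentsDihedralSum {i | ∃ m, D (n, i, m)} (f n) := by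
  let word : ℕ → NatWord := fun c => (Encodable.decode c).getD default
  have hword : Computable word :=
    (Primrec.option_getD_default.comp Primrec.decode).to_comp
  -- The equation on codes rejects numbers that code no word and were decoded to the default.
  let P : ℕ × ℕ × ℕ → Prop := fun p => Encodable.encode (word p.2.1) = p.2.1 ∧
    ∀ i < p.2.1, D (p.1, i, p.2.2) ∨ IsTrivialAt i (word p.2.1)
  have hc : Computable fun p : ℕ × ℕ × ℕ => p.2.1 := Computable.fst.comp Computable.snd
  have hP : ComputablePred P := by
    refine ComputablePred.conj ?_ (ComputablePred.forall_lt
      (p := fun q : (ℕ × ℕ × ℕ) × ℕ => D (q.1.1, q.2, q.1.2.2) ∨ IsTrivialAt q.2 (word q.1.2.1))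
      (ComputablePred.disj ?_ ?_) hc)
    · exact Primrec.eq.computablePred.comp_computable
        (f := fun p : ℕ × ℕ × ℕ => (Encodable.encode (word p.2.1), p.2.1))
        (Computable.pair (Computable.encode.comp (hword.comp hc)) hc)
    · exact hD.comp_computable (Computable.pair (Computable.fst.comp Computable.fst)
        (Computable.pair Computable.snd
          (Computable.snd.comp (Computable.snd.comp Computable.fst))))
    · exact ComputablePred.comp_computable (p := fun p : ℕ × NatWord => IsTrivialAt p.1 p.2)
        (f := fun q : (ℕ × ℕ × ℕ) × ℕ => (q.2, word q.1.2.1)) primrec_isTrivialAt.computablePred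
        (Computable.pair Computable.snd (hword.comp (hc.comp Computable.fst)))
  obtain ⟨g, hg, hce⟩ := exists_computable_ceSet_eq hP
  have hf : Computable fun n => Nat.pair constOneIndex (g n) :=
    Primrec₂.natPair.to_comp.comp (Computable.const constOneIndex) hg
  refine ⟨_, hf, fun n => ⟨by rw [Nat.unpair_pair], fun c => ?_⟩⟩
  rw [Nat.unpair_pair, hce]
  constructor
  · rintro ⟨m, hm, h⟩
    refine ⟨word c, hm, fun i hi => ?_⟩
    by_cases hic : i < c
    · exact (h i hic).resolve_left fun h' => hi ⟨m, h'⟩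
    -- For `i ≥ c` the word has no letter belonging to the `i`-th summand, so it is trivial there.
    · refine lift_dihedralGenerator_eq_one_of_forall_ne _ _ _ fun l hl hli => hic ?_
      have h₁ := fst_lt_wordCode hl
      have h₂ : wordCode (word c) = c := hm
      have h₃ := Nat.unpair_left_le l.1
      omega
  · rintro ⟨w, rfl, h⟩
    have hw : word (wordCode w) = w := by simp [word, wordCode]
    have : ∀ i, ∃ m, D (n, i, m) ∨ IsTrivialAt i w := fun i => by
      by_cases hi : ∃ m, D (n, i, m)
      · exact hi.imp fun m => Or.inl
      · exact ⟨0, Or.inr (h i hi)⟩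
    choose m hm using this
    refine ⟨(Finset.range (wordCode w)).sup m, by simp only [hw]; rfl, fun i hi => ?_⟩
    simp only [hw]
    exact (hm i).imp_left (hmono _ _ _ _ (Finset.le_sup (f := m) (Finset.mem_range.2 hi)))

/-- If `x` works, no `i` with first coordinate at least `x` satisfies the premise. If none works,
take a failure `y x` for each `x ≤ B`; pairing `B` with their maximum gives an `i` that violates the
bound `B`. -/
theorem exists_forall_iff_exists_bound (T : ℕ → ℕ → Prop) :
    (∃ x, ∀ y, T x y) ↔
      ∃ B, ∀ i : ℕ,
        (¬ ∃ x < i.unpair.1 + 1, ∀ y < i.unpair.2 + 1, T x y) → i.unpair.1 < B := by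
  constructor
  · rintro ⟨x, hx⟩
    refine ⟨x, fun i hi => ?_⟩
    by_contra! h
    exact hi ⟨x, by omega, fun y _ => hx y⟩
  · rintro ⟨B, hB⟩
    by_contra! h
    choose y hy using h
    refine absurd (hB (Nat.pair B ((Finset.range (B + 1)).sup y)) ?_) (by simp)
    rintro ⟨x, hx, hT⟩
    simp only [Nat.unpair_pair] at hx hT
    refine hy x (hT _ (Nat.lt_succ_of_le ?_))
    exact Finset.le_sup (f := y) (Finset.mem_range.2 hx)

theorem detectionHard_isNilpotent_resNilRPIndices :
    DetectionHard (IsSigma0 3) resNilRPIndices (fun G _ => Group.IsNilpotent G) := by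
  intro S hS
  obtain ⟨R, hR, hSR⟩ := (isSigma0_three_iff S).1 hS
  -- The stage bounds the search for `z`, which makes `D` computable and monotone in the stage.
  let D : ℕ × ℕ × ℕ → Prop := fun p => ∃ x < p.2.1.unpair.1 + 1, ∀ y < p.2.1.unpair.2 + 1,
    ∃ z < p.2.2, R (Nat.pair (Nat.pair (Nat.pair p.1 x) y) z)
  have hD : ComputablePred D := by
    have hu : Computable fun p : ℕ × ℕ × ℕ => p.2.1.unpair :=
      Primrec.unpair.to_comp.comp (Computable.fst.comp Computable.snd)
    have hpair : Computable₂ Nat.pair := Primrec₂.natPair.to_comp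
    refine ComputablePred.exists_lt (p := fun q : (ℕ × ℕ × ℕ) × ℕ =>
      ∀ y < q.1.2.1.unpair.2 + 1, ∃ z < q.1.2.2,
        R (Nat.pair (Nat.pair (Nat.pair q.1.1 q.2) y) z)) ?_
      (Computable.succ.comp (Computable.fst.comp hu))
    refine ComputablePred.forall_lt (p := fun q : ((ℕ × ℕ × ℕ) × ℕ) × ℕ =>
      ∃ z < q.1.1.2.2, R (Nat.pair (Nat.pair (Nat.pair q.1.1.1 q.1.2) q.2) z)) ?_
      (Computable.succ.comp (Computable.snd.comp (hu.comp Computable.fst)))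
    refine ComputablePred.exists_lt (p := fun q : (((ℕ × ℕ × ℕ) × ℕ) × ℕ) × ℕ =>
      R (Nat.pair (Nat.pair (Nat.pair q.1.1.1.1 q.1.1.2) q.1.2) q.2)) ?_
      (Computable.snd.comp (Computable.snd.comp (Computable.fst.comp Computable.fst)))
    refine hR.comp_computable (hpair.comp (hpair.comp (hpair.comp ?_ ?_) ?_) Computable.snd)
    · exact Computable.fst.comp (Computable.fst.comp (Computable.fst.comp Computable.fst))
    · exact Computable.snd.comp (Computable.fst.comp Computable.fst)
    · exact Computable.snd.comp Computable.fst
  have hmono : ∀ n i m m', m ≤ m' → D (n, i, m) → D (n, i, m') := by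
    rintro n i m m' hm ⟨x, hx, h⟩
    refine ⟨x, hx, fun y hy => ?_⟩
    obtain ⟨z, hz, hzR⟩ := h y hy
    exact ⟨z, hz.trans_le hm, hzR⟩
  obtain ⟨f, hf, hp⟩ := exists_computable_presentsDihedralSum hD hmono
  have hA : ∀ n, f n ∈ resNilRPIndices := fun n =>
    ⟨(hp n).isRPIndex, (hp n).isResiduallyNilpotent⟩
  refine ⟨f, hf, hA, fun n => ?_⟩
  have hK : ∀ i, (∃ m, D (n, i, m)) ↔ ∃ x < i.unpair.1 + 1, ∀ y < i.unpair.2 + 1,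
      ∃ z, R (Nat.pair (Nat.pair (Nat.pair n x) y) z) := by
    intro i
    constructor
    · rintro ⟨m, x, hx, h⟩
      exact ⟨x, hx, fun y hy => (h y hy).imp fun z hz => hz.2⟩
    · rintro ⟨x, hx, h⟩
      choose! z hz using h
      -- Only finitely many `y` matter, so one stage exceeds all their witnesses.
      refine ⟨(Finset.range (i.unpair.2 + 1)).sup z + 1, x, hx, fun y hy => ⟨z y, ?_, hz y hy⟩⟩
      exact Nat.lt_succ_of_le (Finset.le_sup (f := z) (Finset.mem_range.2 hy))
  have hnil := (hp n).isNilpotent_iff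
  simp only [Set.mem_ofPred_eq, hK] at hnil
  rw [hSR, exists_forall_iff_exists_bound, ← hnil]
  exact (and_iff_right (hA n)).symm

theorem mainTheorem7 :
    DetectionComplete (IsSigma0 3) rpIndices (fun G _ => Group.IsNilpotent G) ∧
      DetectionComplete (IsSigma0 3) resNilRPIndices (fun G _ => Group.IsNilpotent G) := by
  have hsub : resNilRPIndices ⊆ rpIndices := fun e he => he.1
  refine ⟨⟨detectionIn_isNilpotent subset_rfl, fun S hS => ?_⟩,
    detectionIn_isNilpotent hsub, detectionHard_isNilpotent_resNilRPIndices⟩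
  -- Hardness passes to the larger index set: the same reduction already takes its values in the
  -- smaller one.
  obtain ⟨f, hf, hA, h⟩ := detectionHard_isNilpotent_resNilRPIndices S hS
  refine ⟨f, hf, fun n => hsub (hA n), fun n => (h n).trans ?_⟩
  exact and_congr_left' (iff_of_true (hA n) (hsub (hA n)))
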